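/- Let $\alpha_j=\begin{pmatrix}0&\sigma_j\\ \sigma_j&0\end{pmatrix}$, $j=1,2,3$, be the $4\times4$ Dirac matrices ($\sigma_j$ the Pauli matrices), let $\mathbf p=-i\nabla$ on $\mathbb R^3$, and fix a norm $\|\cdot\|$ on the space of complex $4\times 4$ matrices. For a measurable matrix-valued function $Q:\mathbb R^3\to\mathbb C^{4\times4}$ with $\|Q(\cdot)\|\in L^3(\mathbb R^3)$, let $H=\alpha\cdot\mathbf p+Q$ and $H_t=\alpha\cdot\mathbf p+tQ$ ($t>0$) be the operator sums in $(L^2(\mathbb R^3))^4$, where $\alpha\cdot\mathbf p=\sum_j\alpha_j(-i\partial_j)$ has domain $(H^{1,2}(\mathbb R^3))^4$, the spinors in $(L^2(\mathbb R^3))^4$ whose first weak derivatives are in $(L^2(\mathbb R^3))^4$, and $Q$ acts by multiplication on $\{u \in (L^2(\mathbb R^3))^4 : Qu\in (L^2(\mathbb R^3))^4\}$. Then: 1. The set of $t>0$ for which $H_t$ has a zero mode, i.e. a non-zero $u$ in its domain with $H_tu=0$, is at most countable. 2. The kernel of $H$ is finite-dimensional, and its dimension $\operatorname{nul}(H)$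 satisfies $$\operatorname{nul}(H)\le C\int_{\mathbb R^3}\|Q(x)\|^3\,dx,$$ where the constant $C$ depends only on the chosen matrix norm, and not on $Q$. -/

import Mathlib

open MeasureTheory
open scoped LineDeriv ENNReal SchwartzMap

noncomputable section

/-- Euclidean space `ℝ³`. -/
abbrev R3 : Type := EuclideanSpace ℝ (Fin 3)

/-- Spinor values: `ℂ⁴` with its standard Hermitian inner product. -/
abbrev Spinor : Type := EuclideanSpace ℂ (Fin 4)

/-- The Hilbert space `(L²(ℝ³))⁴` of square integrable four-component spinors. -/
abbrev SpinorL2 : Type := Lp Spinor 2 (volume : Measure R3)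

/-- The Dirac matrices `α₁, α₂, α₃` in the standard representation, that is the block matrices with
zero diagonal blocks and with the Pauli matrix `σⱼ` as both off-diagonal blocks. -/
def diracAlpha : Fin 3 → Matrix (Fin 4) (Fin 4) ℂ :=
  ![!![0, 0, 0, 1;
       0, 0, 1, 0;
       0, 1, 0, 0;
       1, 0, 0, 0],
    !![0, 0, 0, -Complex.I;
       0, 0, Complex.I, 0;
       0, -Complex.I, 0, 0;
       Complex.I, 0, 0, 0],
    !![0, 0, 1, 0;
       0, 0, 0, -1;
       1, 0, 0, 0;
       0, -1, 0, 0]]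

/-- `g` is the `j`-th weak partial derivative of `u`: the distributional derivative of `u` in the
`j`-th coordinate direction is the distribution given by `g`, i.e.
`∫ φ g = - ∫ (∂ⱼ φ) u` for all test functions `φ`. -/
def IsWeakPartial (j : Fin 3) (u g : SpinorL2) : Prop :=
  ∂_{(EuclideanSpace.single j (1 : ℝ) : R3)} (Lp.toTemperedDistributionCLM Spinor volume 2 u) =
    Lp.toTemperedDistributionCLM Spinor volume 2 g

theorem IsWeakPartial.unique {j : Fin 3} {u g g' : SpinorL2}
    (h : IsWeakPartial j u g) (h' : IsWeakPartial j u g') : g = g' :=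
  LinearMap.ker_eq_bot.mp
    (Lp.ker_toTemperedDistributionCLM_eq_bot (F := Spinor) (μ := (volume : Measure R3)) (p := 2))
    (h.symm.trans h')

theorem IsWeakPartial.add {j : Fin 3} {u v g k : SpinorL2}
    (h : IsWeakPartial j u g) (h' : IsWeakPartial j v k) : IsWeakPartial j (u + v) (g + k) := by
  unfold IsWeakPartial at *
  rw [map_add, map_add, LineDeriv.lineDerivOp_add, h, h']

theorem IsWeakPartial.smul {j : Fin 3} {u g : SpinorL2} (c : ℂ)
    (h : IsWeakPartial j u g) : IsWeakPartial j (c • u) (c • g) := by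
  unfold IsWeakPartial at *
  rw [map_smul, map_smul, LineDeriv.lineDerivOp_smul, h]

theorem IsWeakPartial.zero (j : Fin 3) : IsWeakPartial j 0 0 := by
  simpa using (IsWeakPartial.smul (j := j) (u := 0) (g := 0) (0 : ℂ) (by
    unfold IsWeakPartial
    rw [map_zero, LineDeriv.lineDerivOp_zero]))

/-- The Sobolev space `(H^{1,2}(ℝ³))⁴`: spinors in `L²` all of whose first weak partial derivatives
are in `L²`. -/
def sobolevH1 : Submodule ℂ SpinorL2 where
  carrier := {u | ∀ j : Fin 3, ∃ g : SpinorL2, IsWeakPartial j u g}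
  zero_mem' := fun j => ⟨0, IsWeakPartial.zero j⟩
  add_mem' := fun hu hv j =>
    let ⟨g, hg⟩ := hu j
    let ⟨k, hk⟩ := hv j
    ⟨g + k, hg.add hk⟩
  smul_mem' := fun c _ hu j =>
    let ⟨g, hg⟩ := hu j
    ⟨c • g, hg.smul c⟩

/-- The `j`-th weak partial derivative as a linear map from `(H^{1,2}(ℝ³))⁴` to `(L²(ℝ³))⁴`. -/
def weakPartial (j : Fin 3) : sobolevH1 →ₗ[ℂ] SpinorL2 where
  toFun u := (u.2 j).choose
  map_add' u v := ((u + v).2 j).choose_spec.unique ((u.2 j).choose_spec.add (v.2 j).choose_spec)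
  map_smul' c u := ((c • u).2 j).choose_spec.unique ((u.2 j).choose_spec.smul c)

/-- A constant matrix acting pointwise on the spinors in `L²`. -/
def constMatrixOp (A : Matrix (Fin 4) (Fin 4) ℂ) : SpinorL2 →ₗ[ℂ] SpinorL2 :=
  ((Matrix.toEuclideanCLM (n := Fin 4) (𝕜 := ℂ) A).compLpL 2 (volume : Measure R3)).toLinearMap

/-- The free massless Dirac operator `α · p = ∑ⱼ αⱼ (-i ∂ⱼ)`, an unbounded operator in `L²` with
domain `(H^{1,2}(ℝ³))⁴`. -/
def freeDirac : SpinorL2 →ₗ.[ℂ] SpinorL2 where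
  domain := sobolevH1
  toFun := ∑ j : Fin 3, (-Complex.I) • (constMatrixOp (diracAlpha j) ∘ₗ weakPartial j)

/-- The pointwise product `x ↦ Q(x) u(x)`. -/
def matrixMul (Q : R3 → Matrix (Fin 4) (Fin 4) ℂ) (u : R3 → Spinor) : R3 → Spinor :=
  fun x => Matrix.toEuclideanLin (Q x) (u x)

theorem matrixMul_add_ae (Q : R3 → Matrix (Fin 4) (Fin 4) ℂ) (u v : SpinorL2) :
    matrixMul Q ⇑(u + v) =ᵐ[volume] matrixMul Q u + matrixMul Q v := by
  filter_upwards [Lp.coeFn_add u v] with x hx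
  simp only [matrixMul, hx, Pi.add_apply, map_add]

theorem matrixMul_smul_ae (Q : R3 → Matrix (Fin 4) (Fin 4) ℂ) (c : ℂ) (u : SpinorL2) :
    matrixMul Q ⇑(c • u) =ᵐ[volume] c • matrixMul Q u := by
  filter_upwards [Lp.coeFn_smul c u] with x hx
  simp only [matrixMul, hx, Pi.smul_apply, map_smul]

theorem matrixMul_zero_ae (Q : R3 → Matrix (Fin 4) (Fin 4) ℂ) :
    matrixMul Q ⇑(0 : SpinorL2) =ᵐ[volume] 0 := by
  filter_upwards [Lp.coeFn_zero Spinor 2 (volume : Measure R3)] with x hx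
  simp only [matrixMul, hx, Pi.zero_apply, map_zero]

/-- The operator of multiplication by the matrix-valued function `Q`, with its maximal domain
`{u ∈ L² : Q u ∈ L²}`. -/
def potentialOp (Q : R3 → Matrix (Fin 4) (Fin 4) ℂ) : SpinorL2 →ₗ.[ℂ] SpinorL2 where
  domain :=
    { carrier := {u | MemLp (matrixMul Q u) 2 volume}
      zero_mem' := (memLp_congr_ae (matrixMul_zero_ae Q)).mpr MemLp.zero
      add_mem' := fun {u v} hu hv =>
        (memLp_congr_ae (matrixMul_add_ae Q u v)).mpr (MemLp.add hu hv)
      smul_mem' := fun c u hu =>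
        (memLp_congr_ae (matrixMul_smul_ae Q c u)).mpr (MemLp.const_smul hu c) }
  toFun :=
    { toFun := fun u => MemLp.toLp (matrixMul Q (u : SpinorL2)) u.2
      map_add' := fun u v => by
        rw [← MemLp.toLp_add u.2 v.2]
        exact MemLp.toLp_congr _ _ (matrixMul_add_ae Q u v)
      map_smul' := fun c u => by
        rw [RingHom.id_apply, ← MemLp.toLp_const_smul c u.2]
        exact MemLp.toLp_congr _ _ (matrixMul_smul_ae Q c u) }

/-- The Dirac operator `α · p + Q` as an operator sum; its domain consists of the
`u ∈ (H^{1,2}(ℝ³))⁴` with `Q u ∈ L²`. When `‖Q‖ ∈ L³` the second condition holds for every such `u`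
by the Sobolev embedding of `H^{1,2}` in `L⁶`, so the domain is `(H^{1,2}(ℝ³))⁴`. -/
def diracOp (Q : R3 → Matrix (Fin 4) (Fin 4) ℂ) : SpinorL2 →ₗ.[ℂ] SpinorL2 :=
  freeDirac + potentialOp Q

/-- The operator has a zero mode: an eigenvector for the eigenvalue `0`. -/
def HasZeroMode (H : SpinorL2 →ₗ.[ℂ] SpinorL2) : Prop :=
  ∃ u : H.domain, u ≠ 0 ∧ H u = 0

/-- The kernel of an unbounded operator. -/
def kernel (H : SpinorL2 →ₗ.[ℂ] SpinorL2) : Submodule ℂ H.domain :=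
  LinearMap.ker H.toFun

end

/-! With `f = (α·p)u`, the equation `(α·p + tQ)u = 0` says that `f` is an eigenvector of `A =
Q(α·p)⁻¹` with eigenvalue `-1/t`. Both claims therefore follow from one count: `A` has at most `K ∫
‖Q‖³` linearly independent eigenvectors with eigenvalues of modulus at least 1. The kernel of `H` is
the case of eigenvalue `-1`. For zero modes with `t ≤ T`, replace `Q` by `TQ`: distinct `t` give
distinct eigenvalues `-T/t`, so there are finitely many, and `T` runs through the naturals.

`A` need not be normal, so Gram–Schmidt replaces the eigenvectors by orthonormal `ψₖ` with `⟨ψₖ,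
Aψₖ⟩ = μₖ` (`exists_orthonormal_inner_eq_eigenvalue`), whence `‖Aψₖ‖ ≥ 1`. Put `uₖ = (α·p)⁻¹ψₖ` and
`ρ = ∑ |uₖ|²`. Then `n ≤ ∑ ‖Quₖ‖² ≤ c² ∫ ‖Q‖²ρ`, and Young's inequality together with Lieb's bound
`∫ ρ³ ≤ Cn` (`exists_lintegral_density_cube_le`) absorbs the `ρ` term into `n`.

For Lieb's bound, split each `uₖ` at frequency `E`. Bessel's inequality bounds the low-frequency
density pointwise by `cE`. Taking `E` comparable to `ρ(x)` forces the high-frequency density to be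
comparable to `ρ(x)`, so `ρ³` is at most a constant times `E²` times that density. Summing over
dyadic `E` and applying Plancherel leaves `∑ ‖(α·p)uₖ‖² = n`. -/

/-! ### Fourier transform of `L²` spinors -/

open FourierTransform in
/-- The Fourier transform turns the `j`-th weak partial derivative into multiplication by
`2πi ξⱼ`. -/
theorem IsWeakPartial.fourier_ae {j : Fin 3} {u g : SpinorL2} (h : IsWeakPartial j u g) :
    ∀ᵐ ξ, (𝓕 g : SpinorL2) ξ = (2 * Real.pi * Complex.I * (ξ j : ℂ)) • (𝓕 u : SpinorL2) ξ := by
  have h1 := congrArg (fun T : 𝓢'(R3, Spinor) => 𝓕 T) h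
  simp only [TemperedDistribution.fourier_lineDerivOp_eq, Lp.toTemperedDistributionCLM_apply,
    Lp.fourier_toTemperedDistribution_eq] at h1
  have hloc := (Lp.memLp (𝓕 u : SpinorL2)).locallyIntegrable one_le_two
  refine (ae_eq_of_integral_contDiff_smul_eq ((Lp.memLp _).locallyIntegrable one_le_two) ?_ ?_)
  · exact LocallyIntegrable.continuous_smul (by fun_prop) hloc
  · intro φ hφ hφc
    have hg₁ : HasCompactSupport (Complex.ofRealCLM ∘ φ) := hφc.comp_left rfl
    have hg₂ : ContDiff ℝ ((⊤ : ℕ∞) : WithTop ℕ∞) (Complex.ofRealCLM ∘ φ) := by fun_prop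
    have h2 := congrArg (fun T : 𝓢'(R3, Spinor) => T (hg₁.toSchwartzMap hg₂)) h1
    have hg : (fun x : R3 => ((inner ℝ x (EuclideanSpace.single j (1 : ℝ)) : ℝ) : ℂ)).HasTemperateGrowth := by
      fun_prop
    simp [SchwartzMap.smulLeftCLM_apply_apply hg] at h2
    rw [← h2, ← integral_smul]
    refine integral_congr_ae (.of_forall fun x => ?_)
    simp only [EuclideanSpace.inner_single_right, smul_smul, ← Complex.coe_smul]
    congr 1
    simp
    ring

open FourierTransform in
/-- On `L¹ ∩ L²` the inverse Fourier transform is given by the Fourier integral. -/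
theorem fourierInv_coeFn_ae {v : SpinorL2} (hv : Integrable v) :
    (𝓕⁻ v : SpinorL2) =ᵐ[volume] 𝓕⁻ (v : R3 → Spinor) := by
  have h1 := Lp.fourierInv_toTemperedDistribution_eq v
  refine (ae_eq_of_integral_contDiff_smul_eq ((Lp.memLp _).locallyIntegrable one_le_two) ?_ ?_)
  · refine Continuous.locallyIntegrable ?_
    exact VectorFourier.fourierIntegral_continuous (L := -innerₗ R3) Real.continuous_fourierChar
      (by simp only [LinearMap.neg_apply, innerₗ_apply_apply]; fun_prop) hv
  · intro φ hφ hφc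
    have hg₁ : HasCompactSupport (Complex.ofRealCLM ∘ φ) := hφc.comp_left rfl
    have hg₂ : ContDiff ℝ ((⊤ : ℕ∞) : WithTop ℕ∞) (Complex.ofRealCLM ∘ φ) := by fun_prop
    have h2 := congrArg (fun T : 𝓢'(R3, Spinor) => T (hg₁.toSchwartzMap hg₂)) h1
    simp [SchwartzMap.fourierInv_coe] at h2
    -- `h2` describes the `L²` transform by duality; Fubini moves the integral transform from the
    -- test function to `v`.
    have h3 := VectorFourier.integral_fourierIntegral_smul_eq_flip (L := -innerₗ R3)
      (f := hg₁.toSchwartzMap hg₂)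
      Real.continuous_fourierChar
      (by simp only [LinearMap.neg_apply, innerₗ_apply_apply]; fun_prop) (SchwartzMap.integrable (μ := volume) _) hv
    have hflip : (-innerₗ R3).flip = -innerₗ R3 := by
      ext x y
      simp [real_inner_comm]
    rw [hflip] at h3
    exact h2.symm.trans h3

theorem toTemperedDistribution_constMatrixOp (A : Matrix (Fin 4) (Fin 4) ℂ) (u : SpinorL2)
    (φ : 𝓢(R3, ℂ)) : Lp.toTemperedDistribution (constMatrixOp A u) φ =
      Matrix.toEuclideanCLM (n := Fin 4) (𝕜 := ℂ) A (Lp.toTemperedDistribution u φ) := by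
  simp only [Lp.toTemperedDistribution_apply]
  rw [← ContinuousLinearMap.integral_comp_comm]
  · apply integral_congr_ae
    filter_upwards [ContinuousLinearMap.coeFn_compLp
      (Matrix.toEuclideanCLM (n := Fin 4) (𝕜 := ℂ) A) u] with x hx
    rw [map_smul]
    congr 1
  · exact memLp_one_iff_integrable.mp ((Lp.memLp u).smul (φ.memLp 2))

open FourierTransform in
theorem fourier_constMatrixOp (A : Matrix (Fin 4) (Fin 4) ℂ) (u : SpinorL2) :
    (𝓕 (constMatrixOp A u) : SpinorL2) = constMatrixOp A (𝓕 u) := by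
  apply LinearMap.ker_eq_bot.mp
    (Lp.ker_toTemperedDistributionCLM_eq_bot (F := Spinor) (μ := (volume : Measure R3)) (p := 2))
  ext φ : 1
  simp only [ContinuousLinearMap.coe_coe, Lp.toTemperedDistributionCLM_apply]
  rw [← Lp.fourier_toTemperedDistribution_eq, TemperedDistribution.fourier_apply,
    toTemperedDistribution_constMatrixOp, toTemperedDistribution_constMatrixOp,
    ← Lp.fourier_toTemperedDistribution_eq, TemperedDistribution.fourier_apply]

/-! ### The Dirac symbol and its inverse -/

/-- The symbol `α · ξ` of the free Dirac operator. -/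
noncomputable def diracSymbol (ξ : R3) : Matrix (Fin 4) (Fin 4) ℂ := ∑ j : Fin 3, (ξ j : ℂ) • diracAlpha j

/-- The Clifford relations `αⱼαₖ + αₖαⱼ = 2δⱼₖ`, checked entrywise. They make `(α·ξ)/|ξ|²` the
inverse symbol. -/
theorem diracSymbol_mul_self (ξ : R3) :
    diracSymbol ξ * diracSymbol ξ = ((‖ξ‖ ^ 2 : ℝ) : ℂ) • 1 := by
  rw [EuclideanSpace.real_norm_sq_eq]
  ext a b
  fin_cases a <;> fin_cases b <;>
    simp [diracSymbol, diracAlpha, Fin.sum_univ_three, Matrix.mul_apply, Fin.sum_univ_four] <;>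
    ring_nf <;> simp [Complex.I_sq]

theorem isHermitian_diracSymbol (ξ : R3) : (diracSymbol ξ).IsHermitian := by
  ext a b
  fin_cases a <;> fin_cases b <;>
    simp [diracSymbol, diracAlpha, Fin.sum_univ_three, Matrix.conjTranspose_apply]

/-- The symbol `α · ξ` acting on spinors. -/
noncomputable def diracSymbolCLM (ξ : R3) : Spinor →L[ℂ] Spinor :=
  Matrix.toEuclideanCLM (n := Fin 4) (𝕜 := ℂ) (diracSymbol ξ)

theorem diracSymbolCLM_eq_sum (ξ : R3) : diracSymbolCLM ξ =
    ∑ j : Fin 3, (ξ j : ℂ) • Matrix.toEuclideanCLM (n := Fin 4) (𝕜 := ℂ) (diracAlpha j) := by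
  simp only [diracSymbolCLM, diracSymbol, map_sum, map_smul]

theorem continuous_diracSymbolCLM : Continuous diracSymbolCLM := by
  simp_rw [funext diracSymbolCLM_eq_sum]
  fun_prop

theorem diracSymbolCLM_apply_apply (ξ : R3) (v : Spinor) :
    diracSymbolCLM ξ (diracSymbolCLM ξ v) = ((‖ξ‖ ^ 2 : ℝ) : ℂ) • v := by
  rw [diracSymbolCLM, ← mul_apply_eq_comp, ← map_mul, diracSymbol_mul_self, map_smul,
    map_one]
  rfl

theorem inner_diracSymbolCLM_left (ξ : R3) (v w : Spinor) :
    inner ℂ (diracSymbolCLM ξ v) w = inner ℂ v (diracSymbolCLM ξ w) := by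
  have h : star (diracSymbolCLM ξ) = diracSymbolCLM ξ := by
    rw [diracSymbolCLM, ← map_star, Matrix.star_eq_conjTranspose, isHermitian_diracSymbol ξ]
  nth_rw 1 [← h]
  exact ContinuousLinearMap.adjoint_inner_left _ _ _

theorem norm_diracSymbolCLM (ξ : R3) (v : Spinor) : ‖diracSymbolCLM ξ v‖ = ‖ξ‖ * ‖v‖ := by
  have h : ‖diracSymbolCLM ξ v‖ ^ 2 = (‖ξ‖ * ‖v‖) ^ 2 := by
    rw [← inner_self_eq_norm_sq (𝕜 := ℂ), inner_diracSymbolCLM_left, diracSymbolCLM_apply_apply,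
      inner_smul_right, RCLike.re_to_complex, Complex.re_ofReal_mul, ← RCLike.re_to_complex,
      inner_self_eq_norm_sq, mul_pow]
  exact (sq_eq_sq₀ (norm_nonneg _) (by positivity)).mp h

open FourierTransform in
/-- In Fourier space the free Dirac operator is multiplication by `2π α · ξ`. -/
theorem fourier_freeDirac_ae (u : sobolevH1) : ∀ᵐ ξ,
    (𝓕 (freeDirac u) : SpinorL2) ξ =
      ((2 * Real.pi : ℝ) : ℂ) • diracSymbolCLM ξ ((𝓕 (u : SpinorL2) : SpinorL2) ξ) := by
  have h0 : (𝓕 (freeDirac u) : SpinorL2) =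
      ∑ j : Fin 3, (-Complex.I) • constMatrixOp (diracAlpha j) (𝓕 (weakPartial j u)) := by
    simp_rw [← fourier_constMatrixOp]
    change Lp.fourierTransformₗᵢ R3 Spinor _ = ∑ j : Fin 3, (-Complex.I) •
      Lp.fourierTransformₗᵢ R3 Spinor _
    simp_rw [← map_smul, ← map_sum]
    congr 1
    simp [freeDirac]
  have hw (j : Fin 3) : IsWeakPartial j (u : SpinorL2) (weakPartial j u) := (u.2 j).choose_spec
  have hf (j : Fin 3) := (hw j).fourier_ae
  have hc (j : Fin 3) := ContinuousLinearMap.coeFn_compLp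
      (Matrix.toEuclideanCLM (n := Fin 4) (𝕜 := ℂ) (diracAlpha j)) (𝓕 (weakPartial j u) : SpinorL2)
  have hs (j : Fin 3) := Lp.coeFn_smul (-Complex.I)
    (constMatrixOp (diracAlpha j) (𝓕 (weakPartial j u)))
  rw [h0]
  filter_upwards [ae_all_iff.mpr hf, ae_all_iff.mpr hc, ae_all_iff.mpr hs,
    Lp.coeFn_finsetSum Finset.univ
      (fun j => (-Complex.I) • constMatrixOp (diracAlpha j) (𝓕 (weakPartial j u)))]
    with ξ hf hc hs hsum
  rw [hsum, Finset.sum_apply]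
  have (j : Fin 3) : (constMatrixOp (diracAlpha j) (𝓕 (weakPartial j u))) ξ =
      Matrix.toEuclideanCLM (n := Fin 4) (𝕜 := ℂ) (diracAlpha j)
        ((𝓕 (weakPartial j u) : SpinorL2) ξ) := hc j
  simp only [hs, Pi.smul_apply, this, hf, map_smul, diracSymbolCLM_eq_sum,
    sum_apply, smul_apply, Finset.smul_sum, smul_smul]
  refine Finset.sum_congr rfl fun j _ => ?_
  congr 1
  push_cast
  linear_combination (-2 * Real.pi * (ξ j : ℂ)) * Complex.I_sq

/-! ### Frequency cut-offs and the low-frequency density -/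

open FourierTransform in
/-- The Fourier multiplier with the indicator function of the set `s` of frequencies. -/
noncomputable def freqCut {s : Set R3} (hs : MeasurableSet s) (u : SpinorL2) : SpinorL2 :=
  𝓕⁻ (((Lp.memLp (𝓕 u : SpinorL2)).indicator hs).toLp _)

open FourierTransform in
theorem freqCut_add_freqCut_compl {s : Set R3} (hs : MeasurableSet s) (u : SpinorL2) :
    freqCut hs u + freqCut hs.compl u = u := by
  have h : ((Lp.memLp (𝓕 u : SpinorL2)).indicator hs).toLp _ +
      ((Lp.memLp (𝓕 u : SpinorL2)).indicator hs.compl).toLp _ = (𝓕 u : SpinorL2) := by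
    rw [← MemLp.toLp_add]
    simp only [Set.indicator_self_add_compl, Lp.toLp_coeFn]
  rw [freqCut, freqCut, ← fourierInv_add, h, fourierInv_fourier_eq]

theorem lintegral_enorm_sq_eq (v : SpinorL2) : ∫⁻ x, ‖v x‖ₑ ^ 2 = ‖v‖ₑ ^ 2 := by
  rw [Lp.enorm_def, eLpNorm_eq_lintegral_rpow_enorm_toReal two_ne_zero ENNReal.ofNat_ne_top,
    ← ENNReal.rpow_natCast, ← ENNReal.rpow_mul]
  simp

open FourierTransform in
theorem lintegral_freqCut {s : Set R3} (hs : MeasurableSet s) (u : SpinorL2) :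
    ∫⁻ x, ‖freqCut hs u x‖ₑ ^ 2 = ∫⁻ ξ in s, ‖(𝓕 u : SpinorL2) ξ‖ₑ ^ 2 := by
  have h : ‖freqCut hs u‖ₑ = ‖((Lp.memLp (𝓕 u : SpinorL2)).indicator hs).toLp _‖ₑ := by
    rw [enorm_eq_iff_norm_eq]
    exact (Lp.fourierTransformₗᵢ R3 Spinor).symm.norm_map _
  rw [lintegral_enorm_sq_eq, h, ← lintegral_enorm_sq_eq, ← lintegral_indicator hs]
  refine lintegral_congr_ae ?_
  filter_upwards [((Lp.memLp (𝓕 u : SpinorL2)).indicator hs).coeFn_toLp] with ξ hξ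
  rw [hξ]
  by_cases h : ξ ∈ s <;> simp [h]

theorem integrableOn_ball_norm_inv_sq (E : ℝ) :
    IntegrableOn (fun ξ : R3 => (‖ξ‖ ^ 2)⁻¹) (Metric.ball 0 E) := by
  refine (integrableOn_fun_norm_addHaar volume (f := fun y => (y ^ 2)⁻¹)).mpr ?_
  have : IntegrableOn (fun _ : ℝ => (1 : ℝ)) (Set.Ioo 0 E) := by simp
  refine this.congr_fun (fun y hy => ?_) measurableSet_Ioo
  have := hy.1.ne'
  simp [this]

/-- In dimension three the Jacobian `y²` cancels the singularity, so the integral is linear in `E`.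
This is the source of the bound `cE` on the low-frequency density. -/
theorem integral_ball_norm_inv_sq {E : ℝ} (hE : 0 ≤ E) :
    ∫ ξ in Metric.ball (0 : R3) E, (‖ξ‖ ^ 2)⁻¹ =
      3 * (volume : Measure R3).real (Metric.ball 0 1) * E := by
  have h := integral_fun_norm_addHaar (volume : Measure R3)
    ((Set.Iio E).indicator fun y => (y ^ 2)⁻¹)
  have h1 (ξ : R3) : (Set.Iio E).indicator (fun y => (y ^ 2)⁻¹) ‖ξ‖ =
      (Metric.ball (0 : R3) E).indicator (fun ξ => (‖ξ‖ ^ 2)⁻¹) ξ := by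
    simp [Set.indicator]
  have h2 : ∫ y in Set.Ioi (0 : ℝ), y ^ (Module.finrank ℝ R3 - 1) •
      (Set.Iio E).indicator (fun y => (y ^ 2)⁻¹) y = E := by
    have : ∀ y ∈ Set.Ioi (0 : ℝ), y ^ (Module.finrank ℝ R3 - 1) •
      (Set.Iio E).indicator (fun y => (y ^ 2)⁻¹) y = (Set.Iio E).indicator (fun _ => 1) y := by
      intro y hy
      have := (Set.mem_Ioi.mp hy).ne'
      by_cases hyE : y < E <;> simp [hyE, this]
    rw [setIntegral_congr_fun measurableSet_Ioi this, setIntegral_indicator measurableSet_Iio]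
    simp [Set.Ioi_inter_Iio, hE]
  simp_rw [h1] at h
  rw [integral_indicator measurableSet_ball, h2] at h
  rw [h]
  simp [mul_assoc]

/-- The kernel of the operator `1_{|p| < E} (α · p)⁻¹` in Fourier space. -/
noncomputable def lowFreqKernel (E : ℝ) (x : R3) (w : Spinor) : R3 → Spinor :=
  (Metric.ball 0 E).indicator fun ξ =>
    Real.fourierChar (-inner ℝ ξ x) • (((2 * Real.pi * ‖ξ‖ ^ 2)⁻¹ : ℝ) : ℂ) • diracSymbolCLM ξ w

theorem norm_lowFreqKernel_sq (E : ℝ) (x : R3) (w : Spinor) (ξ : R3) :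
    ‖lowFreqKernel E x w ξ‖ ^ 2 =
      (Metric.ball 0 E).indicator
        (fun ξ => ((2 * Real.pi) ^ 2)⁻¹ * ‖w‖ ^ 2 * (‖ξ‖ ^ 2)⁻¹) ξ := by
  rw [lowFreqKernel]
  by_cases h : ξ ∈ Metric.ball 0 E
  · simp only [h, Set.indicator_of_mem, Circle.norm_smul, norm_smul, norm_diracSymbolCLM,
      Complex.norm_real, norm_inv, Real.norm_of_nonneg
        (show 0 ≤ 2 * Real.pi * ‖ξ‖ ^ 2 by positivity)]
    -- At the origin both sides vanish because `0⁻¹ = 0`.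
    by_cases h0 : ‖ξ‖ = 0
    · simp [h0]
    · field_simp
  · simp [h]

theorem memLp_lowFreqKernel (E : ℝ) (x : R3) (w : Spinor) :
    MemLp (lowFreqKernel E x w) 2 volume := by
  have hm : AEStronglyMeasurable (lowFreqKernel E x w) := by
    refine AEStronglyMeasurable.indicator ?_ measurableSet_ball
    have h1 : Continuous fun ξ => diracSymbolCLM ξ w := continuous_diracSymbolCLM.clm_apply
      continuous_const
    have h2 : Continuous fun ξ : R3 => Real.fourierChar (-inner ℝ ξ x) :=
      Real.continuous_fourierChar.comp (by fun_prop)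
    have h3 : Measurable fun ξ : R3 => (((2 * Real.pi * ‖ξ‖ ^ 2)⁻¹ : ℝ) : ℂ) := by fun_prop
    exact h2.aestronglyMeasurable.smul (h3.aestronglyMeasurable.smul h1.aestronglyMeasurable)
  rw [memLp_two_iff_integrable_sq_norm hm]
  simp_rw [norm_lowFreqKernel_sq]
  rw [integrable_indicator_iff measurableSet_ball]
  exact (integrableOn_ball_norm_inv_sq E).const_mul _

theorem norm_toLp_lowFreqKernel_sq {E : ℝ} (hE : 0 ≤ E) (x : R3) (w : Spinor) :
    ‖(memLp_lowFreqKernel E x w).toLp _‖ ^ 2 =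
      ((2 * Real.pi) ^ 2)⁻¹ * ‖w‖ ^ 2 * (3 * (volume : Measure R3).real (Metric.ball 0 1) * E) := by
  rw [← integral_ball_norm_inv_sq hE, ← integral_const_mul, ← integral_indicator measurableSet_ball]
  rw [← inner_self_eq_norm_sq (𝕜 := ℂ), L2.inner_def]
  have : ∀ᵐ ξ, inner ℂ ((memLp_lowFreqKernel E x w).toLp _ ξ) ((memLp_lowFreqKernel E x w).toLp _ ξ) =
      (((Metric.ball 0 E).indicator
        (fun ξ => ((2 * Real.pi) ^ 2)⁻¹ * ‖w‖ ^ 2 * (‖ξ‖ ^ 2)⁻¹) ξ : ℝ) : ℂ) := by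
    filter_upwards [(memLp_lowFreqKernel E x w).coeFn_toLp] with ξ hξ
    rw [hξ, inner_self_eq_norm_sq_to_K, ← norm_lowFreqKernel_sq E x w ξ]
    simp
  rw [integral_congr_ae this, integral_complex_ofReal]
  exact Complex.ofReal_re _

open FourierTransform in
theorem fourier_eq_symbol_inv_ae (u : sobolevH1) : ∀ᵐ ξ,
    (𝓕 (u : SpinorL2) : SpinorL2) ξ = (((2 * Real.pi * ‖ξ‖ ^ 2)⁻¹ : ℝ) : ℂ) •
      diracSymbolCLM ξ ((𝓕 (freeDirac u) : SpinorL2) ξ) := by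
  have h0 : ∀ᵐ ξ : R3, ξ ≠ 0 := by simp [ae_iff]
  filter_upwards [fourier_freeDirac_ae u, h0] with ξ h hξ
  rw [h, map_smul, diracSymbolCLM_apply_apply, smul_smul, smul_smul]
  have : ‖ξ‖ ≠ 0 := norm_ne_zero_iff.mpr hξ
  rw [← Complex.ofReal_mul, ← Complex.ofReal_mul]
  have : (2 * Real.pi * ‖ξ‖ ^ 2)⁻¹ * (2 * Real.pi) * ‖ξ‖ ^ 2 = 1 := by
    field_simp
  rw [this, Complex.ofReal_one, one_smul]

-- An `L²` function supported in a ball is integrable, so point values of the low-frequency part are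
-- genuine Fourier integrals. Each is then a pairing of `(α·p)u` with a kernel independent of `u`,
-- as Bessel's inequality requires. The exceptional null set comes from Fourier inversion alone and
-- does not depend on `w`.
open FourierTransform in
theorem inner_freqCut_ball_ae (E : ℝ) (u : sobolevH1) : ∀ᵐ x, ∀ w : Spinor,
    inner ℂ w (freqCut (measurableSet_ball (x := (0 : R3)) (ε := E)) u x) =
      inner ℂ ((memLp_lowFreqKernel E x w).toLp _) (𝓕 (freeDirac u) : SpinorL2) := by
  obtain ⟨v, hv⟩ : ∃ v : SpinorL2, v = ((Lp.memLp (𝓕 (u : SpinorL2) : SpinorL2)).indicator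
    (measurableSet_ball (x := (0 : R3)) (ε := E))).toLp _ := ⟨_, rfl⟩
  have hv' : v =ᵐ[volume] (Metric.ball (0 : R3) E).indicator (𝓕 (u : SpinorL2) : SpinorL2) :=
    hv ▸ MemLp.coeFn_toLp _
  have hvint : Integrable v := by
    rw [integrable_congr hv', integrable_indicator_iff measurableSet_ball]
    exact (((Lp.memLp _).locallyIntegrable one_le_two).integrableOn_isCompact
      (isCompact_closedBall 0 E)).mono_set Metric.ball_subset_closedBall
  filter_upwards [fourierInv_coeFn_ae hvint] with x hx w
  rw [freqCut, ← hv, hx, Real.fourierInv_eq, ← integral_inner, L2.inner_def]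
  · refine integral_congr_ae ?_
    filter_upwards [hv', fourier_eq_symbol_inv_ae u, (memLp_lowFreqKernel E x w).coeFn_toLp]
      with ξ h1 h2 h3
    rw [h1, h3, lowFreqKernel]
    by_cases hξ : ξ ∈ Metric.ball (0 : R3) E
    · simp only [hξ, Set.indicator_of_mem]
      rw [h2, Circle.smul_def, Circle.smul_def, inner_smul_left, inner_smul_left, inner_smul_right,
        inner_smul_right, inner_diracSymbolCLM_left, AddChar.map_neg_eq_inv, Circle.coe_inv_eq_conj,
        Complex.conj_ofReal, Complex.conj_conj]
    · simp [hξ]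
  · refine hvint.mono (AEStronglyMeasurable.smul ?_ hvint.1)
      (.of_forall fun ξ => (Circle.norm_smul _ _).le)
    have : Continuous fun ξ : R3 => Real.fourierChar (inner ℝ ξ x) :=
      Real.continuous_fourierChar.comp (by fun_prop)
    exact (continuous_subtype_val.comp this).aestronglyMeasurable

open FourierTransform in
/-- The density of the low frequency parts of a family `uₖ` for which `(α · p) uₖ` is
orthonormal is bounded pointwise, uniformly in the number of functions. -/
theorem exists_sum_norm_freqCut_ball_sq_le : ∃ c : ℝ, 0 < c ∧ ∀ (n : ℕ) (u : Fin n → sobolevH1),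
    Orthonormal ℂ (fun k => freeDirac (u k)) → ∀ E : ℝ, 0 ≤ E → ∀ᵐ x,
      ∑ k, ‖freqCut (measurableSet_ball (x := (0 : R3)) (ε := E)) (u k) x‖ ^ 2 ≤ c * E := by
  have hvol : 0 < (volume : Measure R3).real (Metric.ball 0 1) :=
    ENNReal.toReal_pos (Metric.measure_ball_pos _ _ one_pos).ne' measure_ball_lt_top.ne
  -- The factor 4 counts the coordinate directions of `ℂ⁴`; Bessel's inequality is applied once for
  -- each.
  refine ⟨4 * (((2 * Real.pi) ^ 2)⁻¹ * (3 * (volume : Measure R3).real (Metric.ball 0 1))),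
    by positivity, fun n u hu E hE => ?_⟩
  have hu' : Orthonormal ℂ (fun k => (𝓕 (freeDirac (u k)) : SpinorL2)) :=
    hu.comp_linearIsometryEquiv (Lp.fourierTransformₗᵢ R3 Spinor)
  filter_upwards [ae_all_iff.mpr fun k => inner_freqCut_ball_ae E (u k)] with x hx
  have hnorm (y : Spinor) : ‖y‖ ^ 2 =
      ∑ a, ‖inner ℂ (EuclideanSpace.single a (1 : ℂ)) y‖ ^ 2 := by
    simp [EuclideanSpace.norm_sq_eq, EuclideanSpace.inner_single_left]
  simp_rw [hnorm, hx]
  rw [Finset.sum_comm]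
  calc _ ≤ ∑ a : Fin 4, ‖(memLp_lowFreqKernel E x (EuclideanSpace.single a (1 : ℂ))).toLp _‖ ^ 2 := by
        refine Finset.sum_le_sum fun a _ => ?_
        simp_rw [norm_inner_symm ((memLp_lowFreqKernel E x (EuclideanSpace.single a (1 : ℂ))).toLp _)]
        exact hu'.sum_inner_products_le _
    _ = _ := by
        simp_rw [norm_toLp_lowFreqKernel_sq hE]
        simp
        ring

/-! ### Lieb's inequality by dyadic decomposition -/

/-- A dyadic sum over the scales below `r`. -/
theorem tsum_four_zpow_le (r : ℝ) :
    ∑' m : ℤ, (if (2 : ℝ) ^ m ≤ r then ENNReal.ofReal ((4 : ℝ) ^ m) else 0) ≤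
      ENNReal.ofReal (4 / 3 * r ^ 2) := by
  by_cases hr : 0 < r
  -- With `2^M ≤ r < 2^(M+1)`, the scales that count are `2^(M-j)`, `j ≥ 0`, and the geometric sum
  -- is `4/3 · 4^M`.
  · obtain ⟨M, hM1, hM2⟩ := exists_mem_Ico_zpow hr one_lt_two
    have hinj : Function.Injective fun j : ℕ => M - (j : ℤ) := fun a b h => by
      simpa using h
    rw [← hinj.tsum_eq]
    · have hle : ∀ j : ℕ, (if (2 : ℝ) ^ (M - (j : ℤ)) ≤ r then
          ENNReal.ofReal ((4 : ℝ) ^ (M - (j : ℤ))) else 0) ≤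
          ENNReal.ofReal ((4 : ℝ) ^ M * (1 / 4) ^ j) := by
        intro j
        split_ifs
        · refine (congrArg _ ?_).le
          rw [zpow_sub₀ (by norm_num)]
          simp [div_eq_mul_inv]
        · simp
      refine (ENNReal.tsum_le_tsum hle).trans ?_
      rw [← ENNReal.ofReal_tsum_of_nonneg (fun j => by positivity)
        ((summable_geometric_of_lt_one (by norm_num) (by norm_num)).mul_left _), tsum_mul_left,
        tsum_geometric_of_lt_one (by norm_num) (by norm_num)]
      refine ENNReal.ofReal_le_ofReal ?_
      have h4 : (4 : ℝ) ^ M = ((2 : ℝ) ^ M) ^ 2 := by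
        rw [← zpow_natCast, ← zpow_mul, mul_comm, zpow_mul]
        norm_num
      rw [h4]
      have : ((2 : ℝ) ^ M) ^ 2 ≤ r ^ 2 := by gcongr
      norm_num
      linarith
    · intro m hm
      have hmr : (2 : ℝ) ^ m ≤ r := by
        by_contra h
        simp [h] at hm
      have : m < M + 1 := (zpow_lt_zpow_iff_right₀ one_lt_two).mp (hmr.trans_lt hM2)
      exact ⟨(M - m).toNat, by simp only; omega⟩
  · have (m : ℤ) : ¬ (2 : ℝ) ^ m ≤ r := fun h => hr ((zpow_pos two_pos m).trans_le h)
    simp [this]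

/-- A dyadic choice of scale. -/
theorem exists_zpow_cube_le {c ρ : ℝ} (hc : 0 < c) (hρ : 0 < ρ) {l h : ℤ → ℝ}
    (hsum : ∀ m, ρ ≤ 2 * l m + 2 * h m) (hl : ∀ m, l m ≤ c * (2 : ℝ) ^ m) :
    ∃ m : ℤ, ρ ^ 3 ≤ 256 * c ^ 2 * ((4 : ℝ) ^ m * h m) := by
  -- With `2^m ≤ ρ/(4c) < 2^(m+1)` the low part contributes at most `ρ/2`, hence `ρ ≤ 4h`, while `ρ
  -- ≤ 8c·2^m`; the constant is `8² · 4 = 256`.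
  obtain ⟨m, h1, h2⟩ := exists_mem_Ico_zpow (show 0 < ρ / (4 * c) by positivity) one_lt_two
  refine ⟨m, ?_⟩
  rw [le_div_iff₀ (by positivity)] at h1
  rw [zpow_add_one₀ two_ne_zero, div_lt_iff₀ (by positivity)] at h2
  have h4 : (4 : ℝ) ^ m = ((2 : ℝ) ^ m) ^ 2 := by
    rw [← zpow_natCast, ← zpow_mul, mul_comm, zpow_mul]
    norm_num
  have hhigh : ρ ≤ 4 * h m := by linarith [hsum m, hl m]
  have hsq : ρ ^ 2 ≤ (8 * c * 2 ^ m) ^ 2 := by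
    gcongr
    linarith
  rw [h4]
  calc ρ ^ 3 = ρ ^ 2 * ρ := by ring
    _ ≤ (8 * c * 2 ^ m) ^ 2 * (4 * h m) := by gcongr
    _ = _ := by ring

open FourierTransform in
theorem lintegral_norm_sq_mul_fourier (u : sobolevH1) :
    ∫⁻ ξ : R3, ENNReal.ofReal (4 / 3 * ‖ξ‖ ^ 2) * ‖(𝓕 (u : SpinorL2) : SpinorL2) ξ‖ₑ ^ 2 =
      ENNReal.ofReal (4 / 3 * ((2 * Real.pi) ^ 2)⁻¹) * ‖freeDirac u‖ₑ ^ 2 := by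
  have h : ‖freeDirac u‖ₑ = ‖(𝓕 (freeDirac u) : SpinorL2)‖ₑ := by
    rw [enorm_eq_iff_norm_eq, Lp.norm_fourier_eq]
  rw [h, ← lintegral_enorm_sq_eq, ← lintegral_const_mul' _ _ ENNReal.ofReal_ne_top]
  refine lintegral_congr_ae ?_
  filter_upwards [fourier_freeDirac_ae u] with ξ hξ
  rw [hξ, ← ofReal_norm, ← ofReal_norm, norm_smul, norm_diracSymbolCLM, ← ENNReal.ofReal_pow (by positivity),
    ← ENNReal.ofReal_pow (by positivity), ← ENNReal.ofReal_mul (by positivity),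
    ← ENNReal.ofReal_mul (by positivity), Complex.norm_real, Real.norm_of_nonneg (by positivity)]
  congr 1
  field_simp

open FourierTransform in
/-- **Lieb's inequality** for orthonormal systems in the homogeneous Sobolev space: the density
`ρ = ∑ₖ |uₖ|²` satisfies `∫ ρ³ ≤ C n`. -/
theorem exists_lintegral_density_cube_le : ∃ C : ℝ, 0 < C ∧ ∀ (n : ℕ) (u : Fin n → sobolevH1),
    Orthonormal ℂ (fun k => freeDirac (u k)) →
      ∫⁻ x, ENNReal.ofReal ((∑ k, ‖(u k : SpinorL2) x‖ ^ 2) ^ 3) ≤ ENNReal.ofReal (C * n) := by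
  obtain ⟨c, hc, hlow⟩ := exists_sum_norm_freqCut_ball_sq_le
  refine ⟨256 * c ^ 2 * (4 / 3 * ((2 * Real.pi) ^ 2)⁻¹), by positivity, fun n u hu => ?_⟩
  let B (m : ℤ) : Set R3 := Metric.ball 0 ((2 : ℝ) ^ m)
  have hB (m : ℤ) : MeasurableSet (B m) := measurableSet_ball
  let h (m : ℤ) (x : R3) : ℝ := ∑ k, ‖freqCut (hB m).compl (u k) x‖ ^ 2
  have hpt : ∀ᵐ x, ENNReal.ofReal ((∑ k, ‖(u k : SpinorL2) x‖ ^ 2) ^ 3) ≤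
      ENNReal.ofReal (256 * c ^ 2) *
        ∑' m : ℤ, ENNReal.ofReal ((4 : ℝ) ^ m) * ∑ k, ‖freqCut (hB m).compl (u k) x‖ₑ ^ 2 := by
    have hadd : ∀ᵐ x, ∀ (m : ℤ) (k : Fin n),
        (u k : SpinorL2) x = freqCut (hB m) (u k) x + freqCut (hB m).compl (u k) x := by
      refine ae_all_iff.mpr fun m => ae_all_iff.mpr fun k => ?_
      filter_upwards [Lp.coeFn_add (freqCut (hB m) (u k)) (freqCut (hB m).compl (u k))] with x hx
      rw [← Pi.add_apply, ← hx, freqCut_add_freqCut_compl]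
    filter_upwards [hadd, ae_all_iff.mpr fun m : ℤ => hlow n u hu ((2 : ℝ) ^ m) (by positivity)]
      with x hx hl
    rcases (show 0 ≤ ∑ k, ‖(u k : SpinorL2) x‖ ^ 2 by positivity).eq_or_lt with h0 | h0
    · rw [← h0]
      simp
    have hsum (m : ℤ) : ∑ k, ‖(u k : SpinorL2) x‖ ^ 2 ≤
        2 * ∑ k, ‖freqCut (hB m) (u k) x‖ ^ 2 + 2 * h m x := by
      simp only [h]
      rw [Finset.mul_sum, Finset.mul_sum, ← Finset.sum_add_distrib]
      refine Finset.sum_le_sum fun k _ => ?_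
      rw [hx m k]
      have := norm_add_le (freqCut (hB m) (u k) x) (freqCut (hB m).compl (u k) x)
      nlinarith [norm_nonneg (freqCut (hB m) (u k) x + freqCut (hB m).compl (u k) x),
        sq_nonneg (‖freqCut (hB m) (u k) x‖ - ‖freqCut (hB m).compl (u k) x‖)]
    obtain ⟨m, hm⟩ := exists_zpow_cube_le hc h0 hsum hl
    -- The good scale `m` depends on `x`; bounding its term by the sum over all scales removes this
    -- dependence before integration.
    refine le_trans ?_ (mul_le_mul_right (ENNReal.le_tsum m) _)
    refine (ENNReal.ofReal_le_ofReal hm).trans_eq ?_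
    rw [ENNReal.ofReal_mul (p := 256 * c ^ 2) (by positivity),
      ENNReal.ofReal_mul (p := (4 : ℝ) ^ m) (by positivity),
      ENNReal.ofReal_sum_of_nonneg (fun _ _ => by positivity)]
    simp_rw [ENNReal.ofReal_pow (norm_nonneg _), ofReal_norm]
  have hmeas (v : SpinorL2) : AEMeasurable fun x => ‖v x‖ₑ ^ 2 :=
    (Lp.aestronglyMeasurable v).enorm.pow_const 2
  calc _ ≤ ∫⁻ x, ENNReal.ofReal (256 * c ^ 2) *
        ∑' m : ℤ, ENNReal.ofReal ((4 : ℝ) ^ m) * ∑ k, ‖freqCut (hB m).compl (u k) x‖ₑ ^ 2 :=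
        lintegral_mono_ae hpt
    _ = ENNReal.ofReal (256 * c ^ 2) * ∑ k, ∫⁻ ξ, ∑' m : ℤ, ENNReal.ofReal ((4 : ℝ) ^ m) *
          (B m)ᶜ.indicator (fun ξ => ‖(𝓕 (u k : SpinorL2) : SpinorL2) ξ‖ₑ ^ 2) ξ := by
        rw [lintegral_const_mul' _ _ ENNReal.ofReal_ne_top, lintegral_tsum fun m =>
          (Finset.aemeasurable_fun_sum _ fun k _ => hmeas _).const_mul _]
        simp_rw [lintegral_const_mul' _ _ ENNReal.ofReal_ne_top]
        have (k : Fin n) := lintegral_tsum (μ := (volume : Measure R3))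
          (f := fun (m : ℤ) ξ => ENNReal.ofReal ((4 : ℝ) ^ m) *
          (B m)ᶜ.indicator (fun ξ => ‖(𝓕 (u k : SpinorL2) : SpinorL2) ξ‖ₑ ^ 2) ξ)
          fun m => ((hmeas _).indicator (hB m).compl).const_mul _
        simp_rw [this, lintegral_const_mul' _ _ ENNReal.ofReal_ne_top]
        rw [← Summable.tsum_finsetSum fun _ _ => ENNReal.summable]
        congr 2 with m
        rw [lintegral_finsetSum' _ fun k _ => hmeas _, Finset.mul_sum]
        simp_rw [lintegral_freqCut, lintegral_indicator (hB m).compl]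
    _ ≤ ENNReal.ofReal (256 * c ^ 2) * ∑ k, ∫⁻ ξ : R3, ENNReal.ofReal (4 / 3 * ‖ξ‖ ^ 2) *
          ‖(𝓕 (u k : SpinorL2) : SpinorL2) ξ‖ₑ ^ 2 := by
        gcongr with k _ ξ
        grw [← tsum_four_zpow_le]
        rw [← ENNReal.tsum_mul_right]
        refine (tsum_congr fun m => ?_).le
        simp only [Set.indicator, B, Set.mem_compl_iff, mem_ball_zero_iff, not_lt]
        split_ifs <;> simp
    _ = _ := by
        simp_rw [lintegral_norm_sq_mul_fourier]
        have (k : Fin n) : ‖freeDirac (u k)‖ₑ = 1 := by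
          rw [← ofReal_norm, hu.norm_eq_one k, ENNReal.ofReal_one]
        simp only [this, one_pow, mul_one, Finset.sum_const, Finset.card_univ, Fintype.card_fin,
          nsmul_eq_mul]
        rw [mul_assoc (256 * c ^ 2), ENNReal.ofReal_mul (p := 256 * c ^ 2) (by positivity),
          ENNReal.ofReal_mul (q := (n : ℝ)) (by positivity), ENNReal.ofReal_natCast,
          mul_comm (n : ℝ≥0∞)]

/-! ### From the density bound to a count -/

/-- A linear map out of a finite-dimensional space is bounded with respect to any norm. -/
theorem Seminorm.exists_norm_le_of_finiteDimensional {V F : Type*} [AddCommGroup V] [Module ℂ V]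
    [FiniteDimensional ℂ V] [NormedAddCommGroup F] [NormedSpace ℂ F] (N : Seminorm ℂ V)
    (hN : ∀ v, N v = 0 → v = 0) (f : V →ₗ[ℂ] F) : ∃ c : ℝ, 0 < c ∧ ∀ v, ‖f v‖ ≤ c * N v := by
  let G : AddGroupNorm V := { N.toAddGroupSeminorm with eq_zero_of_map_eq_zero' := hN }
  let _ : NormedAddCommGroup V := G.toNormedAddCommGroup
  let _ : NormedSpace ℂ V := { norm_smul_le := fun a v => (map_smul_eq_mul N a v).le }
  refine ⟨‖LinearMap.toContinuousLinearMap f‖ + 1, by positivity, fun v => ?_⟩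
  refine ((LinearMap.toContinuousLinearMap f).le_opNorm v).trans ?_
  exact mul_le_mul_of_nonneg_right (by linarith) (apply_nonneg N v)

/-- All norms on matrices are comparable; this is how the chosen norm enters the final constant. -/
theorem exists_norm_toEuclideanLin_le (N : Seminorm ℂ (Matrix (Fin 4) (Fin 4) ℂ))
    (hN : ∀ A, N A = 0 → A = 0) : ∃ c : ℝ, 0 < c ∧ ∀ (A : Matrix (Fin 4) (Fin 4) ℂ) (v : Spinor),
      ‖Matrix.toEuclideanLin A v‖ ≤ c * N A * ‖v‖ := by
  obtain ⟨c, hc, h⟩ := N.exists_norm_le_of_finiteDimensional hN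
    ((LinearMap.toContinuousLinearMap (𝕜 := ℂ) (E := Spinor) (F' := Spinor)).toLinearMap ∘ₗ
      (Matrix.toEuclideanLin (𝕜 := ℂ) (m := Fin 4) (n := Fin 4)).toLinearMap)
  refine ⟨c, hc, fun A v => ?_⟩
  exact (ContinuousLinearMap.le_opNorm (LinearMap.toContinuousLinearMap
    (Matrix.toEuclideanLin A)) v).trans (by gcongr; exact h A)

/-- A form of Young's inequality: one of the two terms suffices, according to whether `ρ` or `s * q`
is larger. The parameter `s` serves to make the `ρ³` term small. -/
theorem sq_mul_le_add_cube {q ρ s : ℝ} (hq : 0 ≤ q) (hρ : 0 ≤ ρ) (hs : 0 < s) :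
    q ^ 2 * ρ ≤ s * q ^ 3 + (s ^ 2)⁻¹ * ρ ^ 3 := by
  rcases le_total ρ (s * q) with h | h
  · calc q ^ 2 * ρ ≤ q ^ 2 * (s * q) := by gcongr
      _ = s * q ^ 3 := by ring
      _ ≤ _ := le_add_of_nonneg_right (by positivity)
  · have h2 : (s * q) ^ 2 ≤ ρ ^ 2 := by gcongr
    calc q ^ 2 * ρ = (s ^ 2)⁻¹ * ((s * q) ^ 2 * ρ) := by field_simp
      _ ≤ (s ^ 2)⁻¹ * (ρ ^ 2 * ρ) := by gcongr
      _ = (s ^ 2)⁻¹ * ρ ^ 3 := by ring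
      _ ≤ _ := le_add_of_nonneg_left (by positivity)

/-- The Cwikel–Lieb–Rozenblum bound in its dual form. -/
theorem exists_card_le_of_orthonormal (N : Seminorm ℂ (Matrix (Fin 4) (Fin 4) ℂ))
    (hN : ∀ A, N A = 0 → A = 0) : ∃ K : ℝ, ∀ Q : R3 → Matrix (Fin 4) (Fin 4) ℂ,
      MemLp (fun x => N (Q x)) 3 volume → ∀ (n : ℕ) (u : Fin n → sobolevH1),
        Orthonormal ℂ (fun k => freeDirac (u k)) →
        (∀ k, 1 ≤ ∫⁻ x, ‖matrixMul Q (u k : SpinorL2) x‖ₑ ^ 2) →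
          (n : ℝ) ≤ K * ∫ x, N (Q x) ^ 3 := by
  obtain ⟨c, hc, hQc⟩ := exists_norm_toEuclideanLin_le N hN
  obtain ⟨C, hC, hρ⟩ := exists_lintegral_density_cube_le
  -- With `s² = 2C` the term `s⁻² ∫ ρ³` is at most `n/2` and is absorbed on the left.
  set s : ℝ := Real.sqrt (2 * C)
  have hs : 0 < s := Real.sqrt_pos.mpr (by positivity)
  have hs2 : s ^ 2 = 2 * C := Real.sq_sqrt (by positivity)
  refine ⟨2 * (s * c ^ 3), fun Q hQ n u hu hk => ?_⟩
  have hint : Integrable fun x => N (Q x) ^ 3 := by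
    refine (hQ.integrable_norm_pow (p := 3) (by norm_num)).congr (.of_forall fun x => ?_)
    simp [abs_of_nonneg (apply_nonneg N (Q x))]
  have hmeas (v : SpinorL2) : AEMeasurable fun x =>
      ENNReal.ofReal ((c * N (Q x)) ^ 2 * ‖v x‖ ^ 2) :=
    (((hQ.1.aemeasurable.const_mul c).pow_const 2).mul
      ((Lp.aestronglyMeasurable v).norm.aemeasurable.pow_const 2)).ennreal_ofReal
  have key : ENNReal.ofReal n ≤ ENNReal.ofReal
      (s * c ^ 3 * (∫ x, N (Q x) ^ 3) + (s ^ 2)⁻¹ * (C * n)) := by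
    have hI : 0 ≤ ∫ x, N (Q x) ^ 3 := integral_nonneg fun x => by positivity
    calc ENNReal.ofReal n = ∑ k : Fin n, 1 := by simp
      _ ≤ ∑ k, ∫⁻ x, ENNReal.ofReal ((c * N (Q x)) ^ 2 * ‖(u k : SpinorL2) x‖ ^ 2) := by
          refine Finset.sum_le_sum fun k _ => (hk k).trans (lintegral_mono fun x => ?_)
          rw [← ofReal_norm, ← ENNReal.ofReal_pow (norm_nonneg _), ← mul_pow]
          exact ENNReal.ofReal_le_ofReal (by gcongr; exact hQc _ _)
      _ = ∫⁻ x, ENNReal.ofReal ((c * N (Q x)) ^ 2 * ∑ k, ‖(u k : SpinorL2) x‖ ^ 2) := by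
          rw [← lintegral_finsetSum' _ fun k _ => hmeas _]
          refine lintegral_congr fun x => ?_
          rw [Finset.mul_sum, ENNReal.ofReal_sum_of_nonneg fun _ _ => by positivity]
      _ ≤ ∫⁻ x, (ENNReal.ofReal (s * c ^ 3) * ENNReal.ofReal (N (Q x) ^ 3) +
            ENNReal.ofReal (s ^ 2)⁻¹ *
              ENNReal.ofReal ((∑ k, ‖(u k : SpinorL2) x‖ ^ 2) ^ 3)) := by
          refine lintegral_mono fun x => ?_
          rw [← ENNReal.ofReal_mul (by positivity), ← ENNReal.ofReal_mul (by positivity),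
            ← ENNReal.ofReal_add (by positivity) (by positivity)]
          refine ENNReal.ofReal_le_ofReal ?_
          refine (sq_mul_le_add_cube (by positivity) (by positivity) hs).trans_eq ?_
          ring
      _ = ENNReal.ofReal (s * c ^ 3) * ENNReal.ofReal (∫ x, N (Q x) ^ 3) +
            ENNReal.ofReal (s ^ 2)⁻¹ *
              ∫⁻ x, ENNReal.ofReal ((∑ k, ‖(u k : SpinorL2) x‖ ^ 2) ^ 3) := by
          rw [lintegral_add_left' (hint.1.aemeasurable.ennreal_ofReal.const_mul _),
            lintegral_const_mul' _ _ ENNReal.ofReal_ne_top,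
            lintegral_const_mul' _ _ ENNReal.ofReal_ne_top,
            ofReal_integral_eq_lintegral_ofReal hint (.of_forall fun x => by positivity)]
      _ ≤ _ := by
          grw [hρ n u hu]
          rw [← ENNReal.ofReal_mul (by positivity), ← ENNReal.ofReal_mul (by positivity),
            ← ENNReal.ofReal_add (by positivity) (by positivity)]
  have hI : 0 ≤ ∫ x, N (Q x) ^ 3 := integral_nonneg fun x => by positivity
  have := (ENNReal.ofReal_le_ofReal_iff (by positivity)).mp key
  rw [hs2] at this
  have h2 : (2 * C)⁻¹ * (C * n) = n / 2 := by field_simp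
  linarith

/-! ### Eigenvalues of `Q(α·p)⁻¹` -/

-- The symbol is invertible away from `ξ = 0`, a null set.
open FourierTransform in
theorem freeDirac_injective : Function.Injective freeDirac.toFun := by
  refine (injective_iff_map_eq_zero _).mpr fun u hu => ?_
  replace hu : freeDirac u = 0 := hu
  have h : (𝓕 (u : SpinorL2) : SpinorL2) = 0 := by
    have h0 : (𝓕 (0 : SpinorL2) : SpinorL2) = 0 := (Lp.fourierTransformₗᵢ R3 Spinor).map_zero
    refine Lp.ext ?_
    filter_upwards [fourier_eq_symbol_inv_ae u, Lp.coeFn_zero Spinor 2 (volume : Measure R3)]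
      with ξ h1 h2
    rw [h1, hu, h0, h2]
    simp
  exact Subtype.ext ((Lp.fourierTransformₗᵢ R3 Spinor).map_eq_zero_iff.mp h)

open InnerProductSpace in
/-- Schur triangularisation: on the span of linearly independent eigenvectors there is an
orthonormal family in which the diagonal matrix elements are the eigenvalues. -/
theorem exists_orthonormal_inner_eq_eigenvalue {H : Type*} [NormedAddCommGroup H]
    [InnerProductSpace ℂ H] (A : H →ₗ[ℂ] H) {n : ℕ} {f : Fin n → H} {μ : Fin n → ℂ}
    (hf : LinearIndependent ℂ f) (hA : ∀ k, A (f k) = μ k • f k) :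
    ∃ ψ : Fin n → H, Orthonormal ℂ ψ ∧ (∀ k, ψ k ∈ Submodule.span ℂ (Set.range f)) ∧
      ∀ k, inner ℂ (ψ k) (A (ψ k)) = μ k := by
  refine ⟨gramSchmidtNormed ℂ f, gramSchmidtNormed_orthonormal hf, fun k => ?_, fun k => ?_⟩
  · rw [← span_gramSchmidt, ← span_gramSchmidtNormed_range]
    exact Submodule.subset_span ⟨k, rfl⟩
  set g := gramSchmidtNormed ℂ f with hg
  set W := Submodule.span ℂ (f '' Set.Iio k) with hW
  have hAW : ∀ w ∈ W, A w ∈ W := by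
    intro w hw
    induction hw using Submodule.span_induction with
    | mem x hx =>
      obtain ⟨i, hi, rfl⟩ := hx
      rw [hA]
      exact W.smul_mem _ (Submodule.subset_span ⟨i, hi, rfl⟩)
    | zero => simp
    | add x y _ _ hx hy => rw [map_add]; exact W.add_mem hx hy
    | smul a x _ hx => rw [map_smul]; exact W.smul_mem a hx
  have horth : ∀ w ∈ W, inner ℂ (g k) w = 0 := by
    intro w hw
    rw [hW, ← span_gramSchmidt_Iio, ← span_gramSchmidtNormed] at hw
    induction hw using Submodule.span_induction with
    | mem x hx =>
      obtain ⟨i, hi, rfl⟩ := hx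
      exact (gramSchmidtNormed_orthonormal hf).2 (ne_of_gt hi)
    | zero => simp
    | add x y _ _ hx hy => rw [inner_add_right, hx, hy, add_zero]
    | smul a x _ hx => rw [inner_smul_right, hx, mul_zero]
  obtain ⟨a, w, hw, hgk⟩ : ∃ (a : ℂ) (w : H), w ∈ W ∧ g k = a • (f k - w) := by
    refine ⟨_, f k - gramSchmidt ℂ f k, ?_, by rw [sub_sub_cancel]; rfl⟩
    rw [gramSchmidt_def, sub_sub_cancel, hW, ← span_gramSchmidt_Iio]
    refine Submodule.sum_mem _ fun i hi => ?_
    rw [Submodule.starProjection_singleton]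
    exact Submodule.smul_mem _ _ (Submodule.subset_span ⟨i, Finset.mem_Iio.mp hi, rfl⟩)
  -- `A` acts on `g k` as `μ k` up to a remainder in the invariant span `W` of the earlier
  -- eigenvectors, to which `g k` is orthogonal.
  have hAg : A (g k) = μ k • g k + a • (μ k • w - A w) := by
    rw [hgk, map_smul, map_sub, hA]
    module
  rw [hAg, inner_add_right, inner_smul_right,
    horth _ (W.smul_mem a (W.sub_mem (W.smul_mem _ hw) (hAW w hw))), add_zero,
    inner_self_eq_norm_sq_to_K, (gramSchmidtNormed_orthonormal hf).1 k]
  simp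

/-- The free Dirac operator on the domain of `α · p + Q`. -/
noncomputable def freePart (Q : R3 → Matrix (Fin 4) (Fin 4) ℂ) :
    (diracOp Q).domain →ₗ[ℂ] SpinorL2 :=
  freeDirac.toFun ∘ₗ Submodule.inclusion inf_le_left

/-- Multiplication by `Q` on the domain of `α · p + Q`. -/
noncomputable def potentialPart (Q : R3 → Matrix (Fin 4) (Fin 4) ℂ) :
    (diracOp Q).domain →ₗ[ℂ] SpinorL2 :=
  (potentialOp Q).toFun ∘ₗ Submodule.inclusion inf_le_right

theorem diracOp_apply (Q : R3 → Matrix (Fin 4) (Fin 4) ℂ) (u : (diracOp Q).domain) :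
    diracOp Q u = freePart Q u + potentialPart Q u := rfl

theorem ker_freePart (Q : R3 → Matrix (Fin 4) (Fin 4) ℂ) : (freePart Q).ker = ⊥ :=
  LinearMap.ker_eq_bot.mpr (freeDirac_injective.comp (Submodule.inclusion_injective _))

theorem lintegral_matrixMul_eq (Q : R3 → Matrix (Fin 4) (Fin 4) ℂ) (u : (diracOp Q).domain) :
    ∫⁻ x, ‖matrixMul Q (u : SpinorL2) x‖ₑ ^ 2 = ‖potentialPart Q u‖ₑ ^ 2 := by
  rw [← lintegral_enorm_sq_eq]
  refine lintegral_congr_ae ?_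
  have : potentialPart Q u =ᵐ[volume] matrixMul Q (u : SpinorL2) := MemLp.coeFn_toLp u.2.2
  filter_upwards [this] with x hx
  rw [hx]

/-- The eigenvalues need not be distinct: the triangular basis works for any independent
eigenvectors, and Cauchy–Schwarz turns `|μₖ| ≥ 1` into `‖Aψₖ‖ ≥ 1`. -/
theorem exists_card_le_of_linearIndependent (N : Seminorm ℂ (Matrix (Fin 4) (Fin 4) ℂ))
    (hN : ∀ A, N A = 0 → A = 0) : ∃ K : ℝ, ∀ Q : R3 → Matrix (Fin 4) (Fin 4) ℂ,
      MemLp (fun x => N (Q x)) 3 volume →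
        ∀ (n : ℕ) (e : Fin n → (diracOp Q).domain) (μ : Fin n → ℂ), LinearIndependent ℂ e →
        (∀ k, potentialPart Q (e k) = μ k • freePart Q (e k)) → (∀ k, 1 ≤ ‖μ k‖) →
          (n : ℝ) ≤ K * ∫ x, N (Q x) ^ 3 := by
  obtain ⟨K, hK⟩ := exists_card_le_of_orthonormal N hN
  refine ⟨K, fun Q hQ n e μ he heμ hμ => ?_⟩
  -- A merely algebraic left inverse of `α·p`, defined on all of `L²`. Only its values on the range
  -- of `freePart Q` matter, so no boundedness is needed.
  obtain ⟨L, hL⟩ := (freePart Q).exists_leftInverse_of_injective (ker_freePart Q)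
  have hL' (u : (diracOp Q).domain) : L (freePart Q u) = u := LinearMap.congr_fun hL u
  obtain ⟨ψ, hψ, hspan, hinner⟩ := exists_orthonormal_inner_eq_eigenvalue
    (potentialPart Q ∘ₗ L) (he.map' (freePart Q) (ker_freePart Q)) (μ := μ)
    (fun k => by simp [hL', heμ])
  have hrange (k : Fin n) : freePart Q (L (ψ k)) = ψ k := by
    obtain ⟨w, hw⟩ : ψ k ∈ (freePart Q).range :=
      (Submodule.span_le.mpr (Set.range_comp_subset_range e (freePart Q))) (hspan k)
    rw [← hw, hL']
  refine hK Q hQ n (fun k => ⟨L (ψ k), (L (ψ k)).2.1⟩) ?_ fun k => ?_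
  · have : (fun k => freeDirac ⟨L (ψ k), (L (ψ k)).2.1⟩) = ψ := funext hrange
    exact cast (congrArg (Orthonormal ℂ) this.symm) hψ
  · refine le_trans ?_ (lintegral_matrixMul_eq Q (L (ψ k))).ge
    have h1 : ‖μ k‖ ≤ ‖potentialPart Q (L (ψ k))‖ := by
      rw [← hinner k]
      refine (norm_inner_le_norm _ _).trans ?_
      rw [hψ.norm_eq_one, one_mul]
      rfl
    rw [← ofReal_norm, ← ENNReal.ofReal_one, ← ENNReal.ofReal_pow (norm_nonneg _)]
    exact ENNReal.ofReal_le_ofReal (one_le_pow₀ ((hμ k).trans h1))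

theorem linearIndependent_of_eigenvalue_injective (Q : R3 → Matrix (Fin 4) (Fin 4) ℂ) {n : ℕ}
    {e : Fin n → (diracOp Q).domain} {μ : Fin n → ℂ} (he : ∀ k, e k ≠ 0)
    (heμ : ∀ k, potentialPart Q (e k) = μ k • freePart Q (e k)) (hμ : Function.Injective μ) :
    LinearIndependent ℂ e := by
  obtain ⟨L, hL⟩ := (freePart Q).exists_leftInverse_of_injective (ker_freePart Q)
  have hL' (u : (diracOp Q).domain) : L (freePart Q u) = u := LinearMap.congr_fun hL u
  refine LinearIndependent.of_comp (freePart Q) ?_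
  refine Module.End.eigenvectors_linearIndependent' (potentialPart Q ∘ₗ L) μ hμ _ fun k => ?_
  refine ⟨Module.End.mem_eigenspace_iff.mpr (by simp [hL', heμ]), fun h => he k ?_⟩
  rw [← hL' (e k)]
  exact (congrArg L h).trans (map_zero L)

/-! ### Zero modes -/

theorem freePart_apply (Q : R3 → Matrix (Fin 4) (Fin 4) ℂ) (u : (diracOp Q).domain) :
    freePart Q u = freeDirac ⟨u, u.2.1⟩ := rfl

theorem potentialPart_apply (Q : R3 → Matrix (Fin 4) (Fin 4) ℂ) (u : (diracOp Q).domain)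
    (h : MemLp (matrixMul Q (u : SpinorL2)) 2 volume) : potentialPart Q u = h.toLp _ := rfl

/-- Scaling the potential by `c` turns a zero mode into an eigenvector of `Q'(α·p)⁻¹`, so zero modes
at different couplings can be compared for one fixed potential. -/
theorem HasZeroMode.exists_rescaled {Q Q' : R3 → Matrix (Fin 4) (Fin 4) ℂ} {c : ℂ}
    (hQ : ∀ x, Q' x = c • Q x) (h : HasZeroMode (diracOp Q)) :
    ∃ e : (diracOp Q').domain, e ≠ 0 ∧ potentialPart Q' e = (-c) • freePart Q' e := by
  obtain ⟨u, hu0, hu⟩ := h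
  have hmul : matrixMul Q' (u : SpinorL2) = c • matrixMul Q (u : SpinorL2) := by
    funext x
    simp only [matrixMul, Pi.smul_apply, hQ, map_smul, LinearMap.smul_apply]
  have hmemQ : MemLp (matrixMul Q (u : SpinorL2)) 2 volume := u.2.2
  have hmem : MemLp (matrixMul Q' (u : SpinorL2)) 2 volume := hmul ▸ hmemQ.const_smul c
  obtain ⟨e, he⟩ : ∃ e : (diracOp Q').domain, (e : SpinorL2) = u := ⟨⟨u, u.2.1, hmem⟩, rfl⟩
  refine ⟨e, fun h => hu0 (Subtype.ext ?_), ?_⟩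
  · rw [← he, h]
    rfl
  have h1 : potentialPart Q' e = c • potentialPart Q u := by
    rw [potentialPart_apply Q' e (he ▸ hmem), potentialPart_apply Q u hmemQ,
      ← MemLp.toLp_const_smul]
    refine MemLp.toLp_congr _ _ (.of_eq ?_)
    rw [he, hmul]
  have h2 : freePart Q' e = freePart Q u := by
    rw [freePart_apply, freePart_apply]
    exact congrArg freeDirac (Subtype.ext he)
  rw [diracOp_apply] at hu
  rw [h1, h2, eq_neg_of_add_eq_zero_right hu, smul_neg, neg_smul]

theorem finite_and_finrank_le_of_linearIndependent {V : Type*} [AddCommGroup V] [Module ℂ V]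
    {B : ℝ} (h : ∀ (n : ℕ) (e : Fin n → V), LinearIndependent ℂ e → (n : ℝ) ≤ B) :
    Module.Finite ℂ V ∧ (Module.finrank ℂ V : ℝ) ≤ B := by
  -- The empty family gives `0 ≤ B`, needed to pass to the floor.
  have hB : 0 ≤ B := by simpa using h 0 Fin.elim0 linearIndependent_empty_type
  have hrank : Module.rank ℂ V ≤ (⌊B⌋₊ : ℕ) := rank_le fun s hs =>
    Nat.le_floor (h s.card _ (hs.comp _ s.equivFin.symm.injective))
  exact ⟨Module.rank_lt_aleph0_iff.mp (hrank.trans_lt Cardinal.natCast_lt_aleph0),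
    (Nat.le_floor_iff hB).mp (Module.finrank_le_of_rank_le hrank)⟩

theorem theorem1
    (N : Seminorm ℂ (Matrix (Fin 4) (Fin 4) ℂ)) (hN : ∀ A, N A = 0 → A = 0) :
    (∀ Q : R3 → Matrix (Fin 4) (Fin 4) ℂ, AEStronglyMeasurable Q volume →
      MemLp (fun x => N (Q x)) 3 volume →
        {t : ℝ | 0 < t ∧ HasZeroMode (diracOp (fun x => (t : ℂ) • Q x))}.Countable) ∧
    (∃ C : ℝ, ∀ Q : R3 → Matrix (Fin 4) (Fin 4) ℂ, AEStronglyMeasurable Q volume →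
      MemLp (fun x => N (Q x)) 3 volume →
        Module.Finite ℂ (kernel (diracOp Q)) ∧
        (Module.finrank ℂ (kernel (diracOp Q)) : ℝ) ≤ C * ∫ x, N (Q x) ^ 3) := by
  obtain ⟨K, hK⟩ := exists_card_le_of_linearIndependent N hN
  refine ⟨fun Q _ hQ => ?_, K, fun Q _ hQ => ?_⟩
  -- For `t ≤ T` the eigenvalue `-T/t` of the potential `TQ` has modulus at least 1, so the count
  -- applies.
  · have hfin (T : ℕ) : {t : ℝ | (0 < t ∧ HasZeroMode (diracOp fun x => (t : ℂ) • Q x)) ∧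
        t ≤ T}.Finite := by
      by_contra hinf
      have hQT : MemLp (fun x => N (((T : ℝ) : ℂ) • Q x)) 3 volume := by
        simp_rw [map_smul_eq_mul]
        exact hQ.const_mul _
      obtain ⟨n, hn⟩ := exists_nat_gt (K * ∫ x, N (((T : ℝ) : ℂ) • Q x) ^ 3)
      obtain ⟨s, hs, hcard⟩ := Set.Infinite.exists_subset_card_eq hinf n
      let t : Fin n → s := (s.equivFinOfCardEq hcard).symm
      have ht (k : Fin n) := hs (t k).2
      have hscale (k : Fin n) (x : R3) : ((T : ℝ) : ℂ) • Q x =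
          ((T / t k : ℝ) : ℂ) • ((t k : ℝ) : ℂ) • Q x := by
        rw [smul_smul, ← Complex.ofReal_mul, div_mul_cancel₀ _ (ht k).1.1.ne']
      choose e he0 he using fun k => (ht k).1.2.exists_rescaled (hscale k)
      have hT (k : Fin n) : (0 : ℝ) < T := (ht k).1.1.trans_le (ht k).2
      refine hn.not_ge (hK _ hQT n e _
        (linearIndependent_of_eigenvalue_injective _ he0 he fun i j hij => ?_) he fun k => ?_)
      · have := (hT i).ne'
        have h1 := (ht i).1.1.ne'
        have h2 := (ht j).1.1.ne'
        have hij' := Complex.ofReal_injective (neg_injective hij)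
        field_simp at hij'
        exact (s.equivFinOfCardEq hcard).symm.injective (Subtype.ext (by linarith))
      · rw [norm_neg, Complex.norm_real, Real.norm_of_nonneg (div_pos (hT k) (ht k).1.1).le,
          one_le_div (ht k).1.1]
        exact (ht k).2
    refine (Set.countable_iUnion fun T : ℕ => (hfin T).countable).mono fun t ht => ?_
    obtain ⟨T, hT⟩ := exists_nat_ge t
    exact Set.mem_iUnion.mpr ⟨T, ht, hT⟩
  · refine finite_and_finrank_le_of_linearIndependent fun n e he => ?_
    refine hK Q hQ n _ (fun _ => -1) (he.map' (kernel (diracOp Q)).subtype (Submodule.ker_subtype _))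
      (fun k => ?_) (by simp)
    have h0 : diracOp Q (e k) = 0 := (e k).2
    rw [diracOp_apply] at h0
    rw [neg_one_smul]
    exact eq_neg_of_add_eq_zero_right h0
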